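/- Let $d,r,m_g,m_f\ge 1$, $T>0$, $U\subset\mathbb R^r$, and let $f:[0,T]\times\mathbb R^d\times U\to\mathbb R^d$, $\ell:[0,T]\times\mathbb R^d\times U\to\mathbb R$, $\varphi:\mathbb R^d\to\mathbb R$, $g=(g_1,\dots,g_{m_g}):\mathbb R^d\to\mathbb R^{m_g}$, $g_f=(g_{f,1},\dots,g_{f,m_f}):\mathbb R^d\to\mathbb R^{m_f}$. Assume: (H0) $U$ is compact. (H1a) $f$ is continuous; for every $R>0$ there is $k_R\ge 0$ with $\|f(s,x,u)-f(s,y,u)\|\le k_R\|x-y\|$ for all $\|x\|,\|y\|\le R$ and $(s,u)\in[0,T]\times U$; and there is $c_f>0$ with $\|f(s,x,u)\|\le c_f(1+\|x\|)$ for all $(s,x,u)$. (H1b) $\ell$ is continuous; for every $R>0$ there is $k_R\ge 0$ with $|\ell(s,x,u)-\ell(s,y,u)|\le k_R\|x-y\|$ for all $\|x\|,\|y\|\le R$ and $(s,u)\in[0,T]\times U$; and $c_\ell>0$ is a constant with $|\ell(s,x,u)|\le c_\ell(1+\|x\|)$ for all $(s,x,u)$. (H2) $\varphi$ is locally Lipschitz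 and $|\varphi(y)|\le c_\varphi(1+\|y\|)$ for all $y$, for some $c_\varphi\ge 0$. (H3) $g$ and $g_f$ are locally Lipschitz and $\|g(y)\|+\|g_f(y)\|\le c_g(1+\|y\|)$ for all $y$, for some $c_g\ge 0$. (H4) For every $s\in[0,T]$ and $x\in\mathbb R^d$ the set $$\bigl\{(f(s,x,u),\,-\ell(s,x,u)+\eta)\;:\;u\in U,\ -c_\ell(1+\|x\|)+\ell(s,x,u)\le\eta\le 0\bigr\}\subset\mathbb R^d\times\mathbb R$$ is convex, with the constant $c_\ell$ of (H1b). Let $\mathcal U$ be the set of measurable $u:[0,T]\to\mathbb R^r$ with $u(s)\in U$ for a.e. $s$. For $t\in[0,T]$, $x\in\mathbb R^d$, $z\in\mathbb R$, let $\mathbb X_{[t,T]}(x)$ be the set of pairs $(\mathbf x,u)$ with $u\in\mathcal U$ and $\mathbf x:[t,T]\to\mathbb R^d$ absolutely continuous such that $\dot{\mathbf x}(s)=f(s,\mathbf x(s),u(s))$ for a.e. $s\in(t,T)$ and $\mathbf x(t)=x$. Let $\mathcal S_{[t,T]}(x,z)$ be the set of pairs $(\mathbf x,\zeta)$ of absolutely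 continuous functions on $[t,T]$ for which there is $u\in\mathcal U$ with $\dot{\mathbf x}(s)=f(s,\mathbf x(s),u(s))$ and $\dot\zeta(s)=-\ell(s,\mathbf x(s),u(s))$ for a.e. $s\in(t,T)$, $\mathbf x(t)=x$ and $\zeta(t)=z$. Put $G=\max_i g_i$, $G_f=\max_j g_{f,j}$ and define, with $\inf\emptyset=+\infty$, $$\mathcal V(t,x)=\inf\Bigl\{\varphi(\mathbf x(T))+\int_t^T\ell(s,\mathbf x(s),u(s))\,ds\;:\;(\mathbf x,u)\in\mathbb X_{[t,T]}(x),\ g(\mathbf x(s))\le 0\ \text{for all } s\in[t,T],\ g_f(\mathbf x(T))\le 0\Bigr\},$$ $$\mathcal W(t,x,z)=\inf_{(\mathbf x,\zeta)\in\mathcal S_{[t,T]}(x,z)}\max\Bigl\{\varphi(\mathbf x(T))-\zeta(T),\ \max_{\theta\in[t,T]}G(\mathbf x(\theta)),\ G_f(\mathbf x(T))\Bigr\}.$$ (Vector inequalities are componentwise.) Theorem. For every $t\in[0,T]$ and $x\in\mathbb R^d$: (i) for every $z\in\mathbb R$, $\mathcal V(t,x)\le z$ if and only if $\mathcal W(t,x,z)\le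 0$; (ii) $\mathcal V(t,x)=\min\{z\in\mathbb R:\mathcal W(t,x,z)\le 0\}$. That is, $\mathcal V(t,x)$ is the infimum of this set in the extended reals, equal to $+\infty$ if the set is empty; and if the set is nonempty, then $\mathcal V(t,x)$ is finite and is the least element of the set. -/

import Mathlib

open MeasureTheory Set

/-- The data of a state-constrained Bolza problem on `[0, T]` with states in `ℝ^d`, controls in
`ℝ^r`, `mg` running state constraints and `mf` final constraints. Functions of time (and of the
control) are total; only their values for `s ∈ [0, T]` (and `u ∈ U`) are used. -/
structure BolzaData (d r mg mf : ℕ) where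
  /-- time horizon -/
  T : ℝ
  /-- control set -/
  U : Set (EuclideanSpace ℝ (Fin r))
  /-- dynamics -/
  f : ℝ → EuclideanSpace ℝ (Fin d) → EuclideanSpace ℝ (Fin r) → EuclideanSpace ℝ (Fin d)
  /-- distributed cost -/
  l : ℝ → EuclideanSpace ℝ (Fin d) → EuclideanSpace ℝ (Fin r) → ℝ
  /-- final cost -/
  phi : EuclideanSpace ℝ (Fin d) → ℝ
  /-- running state constraints `g ≤ 0` -/
  g : EuclideanSpace ℝ (Fin d) → EuclideanSpace ℝ (Fin mg)
  /-- final state constraints `gf ≤ 0` -/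
  gf : EuclideanSpace ℝ (Fin d) → EuclideanSpace ℝ (Fin mf)

namespace BolzaData

variable {d r mg mf : ℕ} (P : BolzaData d r mg mf)

/-! ### Assumptions -/

/-- (H0): the control set is compact. -/
def H0 : Prop := IsCompact P.U

/-- (H1a): the dynamics is continuous on `[0,T] × ℝ^d × U`, locally Lipschitz in the state
uniformly in time and control, and has linear growth. -/
def H1a : Prop :=
  ContinuousOn
      (fun q : ℝ × EuclideanSpace ℝ (Fin d) × EuclideanSpace ℝ (Fin r) => P.f q.1 q.2.1 q.2.2)
      (Icc 0 P.T ×ˢ univ ×ˢ P.U) ∧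
    (∀ R : ℝ, 0 < R → ∃ k : ℝ, 0 ≤ k ∧
      ∀ x ∈ Metric.closedBall (0 : EuclideanSpace ℝ (Fin d)) R,
      ∀ y ∈ Metric.closedBall (0 : EuclideanSpace ℝ (Fin d)) R,
      ∀ s ∈ Icc 0 P.T, ∀ u ∈ P.U, ‖P.f s x u - P.f s y u‖ ≤ k * ‖x - y‖) ∧
    (∃ cf : ℝ, 0 < cf ∧ ∀ s ∈ Icc 0 P.T, ∀ x, ∀ u ∈ P.U, ‖P.f s x u‖ ≤ cf * (1 + ‖x‖))

/-- (H1b): the same for the distributed cost, with the growth constant `cl` exhibited because it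
also appears in (H4). -/
def H1b (cl : ℝ) : Prop :=
  ContinuousOn
      (fun q : ℝ × EuclideanSpace ℝ (Fin d) × EuclideanSpace ℝ (Fin r) => P.l q.1 q.2.1 q.2.2)
      (Icc 0 P.T ×ˢ univ ×ˢ P.U) ∧
    (∀ R : ℝ, 0 < R → ∃ k : ℝ, 0 ≤ k ∧
      ∀ x ∈ Metric.closedBall (0 : EuclideanSpace ℝ (Fin d)) R,
      ∀ y ∈ Metric.closedBall (0 : EuclideanSpace ℝ (Fin d)) R,
      ∀ s ∈ Icc 0 P.T, ∀ u ∈ P.U, |P.l s x u - P.l s y u| ≤ k * ‖x - y‖) ∧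
    (0 < cl ∧ ∀ s ∈ Icc 0 P.T, ∀ x, ∀ u ∈ P.U, |P.l s x u| ≤ cl * (1 + ‖x‖))

/-- (H2): the final cost is locally Lipschitz with linear growth. -/
def H2 : Prop :=
  LocallyLipschitz P.phi ∧ ∃ c : ℝ, 0 ≤ c ∧ ∀ y, |P.phi y| ≤ c * (1 + ‖y‖)

/-- (H3): the constraint functions are locally Lipschitz with linear growth. -/
def H3 : Prop :=
  LocallyLipschitz P.g ∧ LocallyLipschitz P.gf ∧
    ∃ c : ℝ, 0 ≤ c ∧ ∀ y, ‖P.g y‖ + ‖P.gf y‖ ≤ c * (1 + ‖y‖)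

/-- (H4): convex epigraph condition for the augmented dynamics. -/
def H4 (cl : ℝ) : Prop :=
  ∀ s ∈ Icc 0 P.T, ∀ x : EuclideanSpace ℝ (Fin d),
    Convex ℝ {p : EuclideanSpace ℝ (Fin d) × ℝ | ∃ u ∈ P.U, ∃ η : ℝ,
      -cl * (1 + ‖x‖) + P.l s x u ≤ η ∧ η ≤ 0 ∧ p = (P.f s x u, -P.l s x u + η)}

/-! ### Controls and trajectories -/

/-- Admissible controls: (Lebesgue) measurable on `[0, T]` with values in `U` almost everywhere. -/
def Controls : Set (ℝ → EuclideanSpace ℝ (Fin r)) :=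
  {u | AEMeasurable u (volume.restrict (Icc 0 P.T)) ∧
    ∀ᵐ s ∂(volume.restrict (Icc 0 P.T)), u s ∈ P.U}

/-- `𝕏_{[t,T]}(x)`: the admissible pairs of a trajectory and a control. The trajectory is absolutely
continuous on `[t, T]`, solves the state equation almost everywhere and starts from `x` at time
`t`. -/
def Pairs (t : ℝ) (x : EuclideanSpace ℝ (Fin d)) :
    Set ((ℝ → EuclideanSpace ℝ (Fin d)) × (ℝ → EuclideanSpace ℝ (Fin r))) :=
  {p | p.2 ∈ P.Controls ∧ AbsolutelyContinuousOnInterval p.1 t P.T ∧ p.1 t = x ∧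
    ∀ᵐ s ∂(volume.restrict (Ioo t P.T)), HasDerivAt p.1 (P.f s (p.1 s) (p.2 s)) s}

/-- `𝒮_{[t,T]}(x, z)`: the trajectories on `[t, T]` of the augmented system
`x' = f(s, x, u)`, `ζ' = -ℓ(s, x, u)` that start from `(x, z)` at time `t`. -/
def AugTrajectories (t : ℝ) (x : EuclideanSpace ℝ (Fin d)) (z : ℝ) :
    Set ((ℝ → EuclideanSpace ℝ (Fin d)) × (ℝ → ℝ)) :=
  {y | AbsolutelyContinuousOnInterval y.1 t P.T ∧ AbsolutelyContinuousOnInterval y.2 t P.T ∧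
    y.1 t = x ∧ y.2 t = z ∧
    ∃ u ∈ P.Controls, ∀ᵐ s ∂(volume.restrict (Ioo t P.T)),
      HasDerivAt y.1 (P.f s (y.1 s) (u s)) s ∧ HasDerivAt y.2 (-P.l s (y.1 s) (u s)) s}

/-! ### Value functions -/

/-- The state-constrained value function, with `inf ∅ = +∞`. -/
noncomputable def V (t : ℝ) (x : EuclideanSpace ℝ (Fin d)) : EReal :=
  ⨅ p ∈ {p ∈ P.Pairs t x |
      (∀ s ∈ Icc t P.T, ∀ i, P.g (p.1 s) i ≤ 0) ∧ ∀ j, P.gf (p.1 P.T) j ≤ 0},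
    ((P.phi (p.1 P.T) + ∫ s in t..P.T, P.l s (p.1 s) (p.2 s) : ℝ) : EReal)

/-- `G(y) = max (g₁(y), …, g_{mg}(y))`. -/
noncomputable def G [NeZero mg] (y : EuclideanSpace ℝ (Fin d)) : ℝ :=
  Finset.univ.sup' Finset.univ_nonempty fun i => P.g y i

/-- `G_f(y) = max (g_{f,1}(y), …, g_{f,mf}(y))`. -/
noncomputable def Gf [NeZero mf] (y : EuclideanSpace ℝ (Fin d)) : ℝ :=
  Finset.univ.sup' Finset.univ_nonempty fun j => P.gf y j

/-- The auxiliary value function, in which the constraints enter the cost. The supremum over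
`θ ∈ [t, T]` is a maximum for `t ≤ T`, since trajectories and `G` are continuous. -/
noncomputable def W [NeZero mg] [NeZero mf] (t : ℝ) (x : EuclideanSpace ℝ (Fin d)) (z : ℝ) :
    EReal :=
  ⨅ y ∈ P.AugTrajectories t x z,
    max ((P.phi (y.1 P.T) - y.2 P.T : ℝ) : EReal)
      (max (⨆ θ ∈ Icc t P.T, (P.G (y.1 θ) : EReal)) (P.Gf (y.1 P.T) : EReal))

end BolzaData

/-! ### Mean-value and Grönwall estimates for absolutely continuous curves. -/

section AbsolutelyContinuous

open Filter Topology

variable {E : Type*} [NormedAddCommGroup E] [NormedSpace ℝ E]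

/-! Everything reduces to `V ≤ z ↔ W ≤ 0`. For the forward direction (`W_le_of_V_lt`), a feasible
pair of cost below `z + ε` is augmented by `ζ(s) = z - ∫ ℓ`, which makes every term of the maximum
at most `ε`.

The converse (`exists_cost_le_of_W_le_zero`) is an existence argument. Augmented trajectories of
value at most `1/(n+1)` are equi-Lipschitz by Grönwall, hence converge pointwise along an
ultrafilter. Average velocities over short intervals stay near a closed set, convex by (H4), so the
limit has its velocities in that set (`mem_augVelocities_of_tendsto`). Filippov selection
(`exists_control_of_ae_mem_augVelocities`) then gives a control with `ξ' = f` and `ζ' ≤ -ℓ`: the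
slack `η ≤ 0` has the favourable sign, so the true cost is at most `φ(ξ(T)) - ζ(T) + z ≤ z`. Thus
the infimum need not be attained in the original augmented system.

The minimum statement is then order theory, with `V_ne_bot` excluding `-∞`. -/

theorem LipschitzWith.comp_absolutelyContinuousOnInterval {X Y : Type*} [PseudoMetricSpace X]
    [PseudoMetricSpace Y] {K : NNReal} {g : X → Y} (hg : LipschitzWith K g) {f : ℝ → X} {a b : ℝ}
    (hf : AbsolutelyContinuousOnInterval f a b) :
    AbsolutelyContinuousOnInterval (fun s => g (f s)) a b := by
  have h := Tendsto.const_mul (K : ℝ) hf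
  rw [mul_zero] at h
  refine squeeze_zero (fun E => Finset.sum_nonneg fun i _ => dist_nonneg) (fun E => ?_) h
  rw [Finset.mul_sum]
  exact Finset.sum_le_sum fun i _ => hg.dist_le_mul _ _

theorem AbsolutelyContinuousOnInterval.sub_le_of_ae_hasDerivAt_le {f : ℝ → ℝ} {a b c : ℝ}
    (hab : a ≤ b) (hf : AbsolutelyContinuousOnInterval f a b)
    (h : ∀ᵐ s ∂volume.restrict (Ioo a b), ∃ v, HasDerivAt f v s ∧ v ≤ c) :
    f b - f a ≤ c * (b - a) := by
  rw [← hf.integral_deriv_eq_sub]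
  calc ∫ s in a..b, deriv f s ≤ ∫ _ in a..b, c := by
        refine intervalIntegral.integral_mono_ae_restrict hab hf.intervalIntegrable_deriv
          intervalIntegrable_const ?_
        rw [← restrict_Ioo_eq_restrict_Icc]
        filter_upwards [h] with s ⟨v, hv, hvc⟩
        rw [hv.deriv]
        exact hvc
    _ = c * (b - a) := by simp [mul_comm]

/-- A slope outside `C` would be strictly separated from `C` by a functional, contradicting the
scalar estimate. Only scalar functions are integrated, so `E` need not be complete. -/
theorem AbsolutelyContinuousOnInterval.slope_mem_of_ae_hasDerivAt {f : ℝ → E} {a b : ℝ}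
    (hab : a < b) (hf : AbsolutelyContinuousOnInterval f a b) {C : Set E} (hC : Convex ℝ C)
    (hC' : IsClosed C)
    (h : ∀ᵐ s ∂volume.restrict (Ioo a b), ∃ v, HasDerivAt f v s ∧ v ∈ C) :
    (b - a)⁻¹ • (f b - f a) ∈ C := by
  by_contra hn
  obtain ⟨L, c, hLC, hc⟩ := geometric_hahn_banach_closed_point hC hC' hn
  have hLf := L.lipschitz.comp_absolutelyContinuousOnInterval hf
  have := hLf.sub_le_of_ae_hasDerivAt_le hab.le (c := c) (by
    filter_upwards [h] with s ⟨v, hv, hvC⟩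
    exact ⟨L v, L.hasFDerivAt.comp_hasDerivAt s hv, (hLC v hvC).le⟩)
  rw [map_smul, smul_eq_mul, map_sub, inv_mul_eq_div, lt_div_iff₀ (by linarith)] at hc
  linarith

theorem AbsolutelyContinuousOnInterval.lipschitzOnWith_of_ae_hasDerivAt {f : ℝ → E} {a b : ℝ}
    (hab : a ≤ b) (hf : AbsolutelyContinuousOnInterval f a b) {K : NNReal}
    (h : ∀ᵐ s ∂volume.restrict (Ioo a b), ∃ v, HasDerivAt f v s ∧ ‖v‖ ≤ K) :
    LipschitzOnWith K f (Icc a b) := by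
  have key : ∀ s ∈ Icc a b, ∀ r ∈ Icc a b, s < r → ‖f r - f s‖ ≤ K * (r - s) := by
    intro s hs r hr hsr
    have h1 : AbsolutelyContinuousOnInterval f s r := hf.mono (by
      rw [uIcc_of_le hab, uIcc_of_le hsr.le]
      exact Icc_subset_Icc hs.1 hr.2)
    have h2 := h1.slope_mem_of_ae_hasDerivAt hsr (convex_closedBall (0 : E) K)
      Metric.isClosed_closedBall (by
        filter_upwards [ae_restrict_of_ae_restrict_of_subset (Ioo_subset_Ioo hs.1 hr.2) h]
          with τ ⟨v, hv, hvK⟩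
        exact ⟨v, hv, by simpa using hvK⟩)
    have h3 : 0 < r - s := by linarith
    rw [mem_closedBall_zero_iff, norm_smul, norm_inv, Real.norm_of_nonneg h3.le,
      inv_mul_le_iff₀ h3] at h2
    linarith
  refine LipschitzOnWith.of_dist_le_mul fun s hs r hr => ?_
  rcases lt_trichotomy s r with hsr | rfl | hsr
  · rw [dist_eq_norm', dist_comm, Real.dist_eq, abs_of_pos (by linarith)]
    exact key s hs r hr hsr
  · simp
  · rw [dist_eq_norm, Real.dist_eq, abs_of_pos (by linarith)]
    exact key r hr s hs hsr

/-- The reverse triangle inequality bounds slopes of the norm by norms of slopes. -/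
theorem HasDerivAt.le_norm_of_hasDerivAt_norm {f : ℝ → E} {v : E} {s w : ℝ} (hf : HasDerivAt f v s)
    (hn : HasDerivAt (fun r => ‖f r‖) w s) : w ≤ ‖v‖ := by
  rw [hasDerivAt_iff_tendsto_slope] at hf hn
  refine le_of_tendsto_of_tendsto hn hf.norm (Eventually.of_forall fun r => ?_)
  simp only [slope, vsub_eq_sub, smul_eq_mul, norm_smul]
  refine (le_abs_self _).trans ?_
  rw [abs_mul, ← Real.norm_eq_abs]
  gcongr
  exact abs_norm_sub_norm_le _ _

/-- A Grönwall bound for absolutely continuous curves of linear growth. -/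
theorem AbsolutelyContinuousOnInterval.one_add_norm_le_of_linear_growth {f : ℝ → E} {a b c : ℝ}
    (hf : AbsolutelyContinuousOnInterval f a b)
    (h : ∀ᵐ s ∂volume.restrict (Ioo a b), ∃ v, HasDerivAt f v s ∧ ‖v‖ ≤ c * (1 + ‖f s‖))
    {s : ℝ} (hs : s ∈ Icc a b) :
    1 + ‖f s‖ ≤ Real.exp (c * (s - a)) * (1 + ‖f a‖) := by
  have hn : AbsolutelyContinuousOnInterval (fun r => ‖f r‖) a b :=
    lipschitzWith_one_norm.comp_absolutelyContinuousOnInterval hf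
  have hone : AbsolutelyContinuousOnInterval (fun _ : ℝ => (1 : ℝ)) a b :=
    ((LipschitzWith.const (1 : ℝ)).lipschitzOnWith (s := uIcc a b)).absolutelyContinuousOnInterval
  have hexp : AbsolutelyContinuousOnInterval (fun r => Real.exp (-c * (r - a))) a b :=
    ContDiffOn.absolutelyContinuousOnInterval (by fun_prop)
  -- With the integrating factor, the product has nonpositive derivative almost everywhere, hence
  -- cannot increase.
  have hm : AbsolutelyContinuousOnInterval
      (fun r => Real.exp (-c * (r - a)) * (1 + ‖f r‖)) a b := hexp.fun_mul (hone.fun_add hn)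
  have hab : a ≤ b := hs.1.trans hs.2
  have hms := hm.mono (c := a) (d := s) (by
    rw [uIcc_of_le hab, uIcc_of_le hs.1]
    exact Icc_subset_Icc_right hs.2)
  have hd : ∀ᵐ r ∂volume.restrict (Ioo a b), DifferentiableAt ℝ (fun r => ‖f r‖) r := by
    rw [ae_restrict_iff' measurableSet_Ioo]
    filter_upwards [hn.ae_differentiableAt] with r hr hr'
    exact hr (by rw [uIcc_of_le hab]; exact Ioo_subset_Icc_self hr')
  have := hms.sub_le_of_ae_hasDerivAt_le hs.1 (c := 0) (by
    refine ae_restrict_of_ae_restrict_of_subset (Ioo_subset_Ioo_right hs.2) ?_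
    filter_upwards [h, hd] with r ⟨v, hv, hvc⟩ hr
    have h1 : HasDerivAt (fun r => Real.exp (-c * (r - a)))
        (Real.exp (-c * (r - a)) * (-c)) r := by
      simpa using (((hasDerivAt_id r).sub_const a).const_mul (-c)).exp
    refine ⟨_, h1.mul (hr.hasDerivAt.const_add 1), ?_⟩
    have h2 := hv.le_norm_of_hasDerivAt_norm hr.hasDerivAt
    have h3 := Real.exp_pos (-c * (r - a))
    have : Real.exp (-c * (r - a)) * (deriv (fun r => ‖f r‖) r - c * (1 + ‖f r‖)) ≤ 0 :=
      mul_nonpos_of_nonneg_of_nonpos h3.le (by linarith)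
    linarith)
  simp only [sub_self, mul_zero, Real.exp_zero, one_mul, zero_mul, sub_nonpos] at this
  calc 1 + ‖f s‖ = Real.exp (c * (s - a)) * (Real.exp (-c * (s - a)) * (1 + ‖f s‖)) := by
        rw [← mul_assoc, ← Real.exp_add]
        simp
    _ ≤ _ := by gcongr

/-- If almost all velocities of `y n` just after `s` are eventually close to a closed convex set,
then the velocity at `s` of a pointwise limit belongs to this set. -/
theorem HasDerivAt.mem_of_tendsto_of_ae_mem_cthickening {ι : Type*} {l : Filter ι} [l.NeBot]
    {y : ι → ℝ → E} {y₀ : ℝ → E} {v : E} {s b : ℝ} (hsb : s < b)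
    (hy : ∀ n, AbsolutelyContinuousOnInterval (y n) s b)
    (hlim : ∀ τ ∈ Icc s b, Tendsto (fun n => y n τ) l (𝓝 (y₀ τ)))
    (hv : HasDerivAt y₀ v s) {C : Set E} (hC : Convex ℝ C) (hC' : IsClosed C)
    (h : ∀ ε > 0, ∃ δ > 0, ∀ᶠ n in l, ∀ᵐ τ ∂volume.restrict (Ioo s b), τ < s + δ →
      ∃ w, HasDerivAt (y n) w τ ∧ w ∈ Metric.cthickening ε C) :
    v ∈ C := by
  rw [← hC'.closure_eq, Metric.closure_eq_iInter_cthickening]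
  refine mem_iInter₂.2 fun ε hε => ?_
  obtain ⟨δ, hδ, hev⟩ := h ε hε
  have hslope : Tendsto (slope y₀ s) (𝓝[>] s) (𝓝 v) :=
    (hasDerivAt_iff_tendsto_slope.1 hv).mono_left (nhdsWithin_mono _ fun r hr => ne_of_gt hr)
  refine Metric.isClosed_cthickening.mem_of_tendsto hslope ?_
  have hmem : Ioo s (min b (s + δ)) ∈ 𝓝[>] s := Ioo_mem_nhdsGT (by simp [hsb, hδ])
  filter_upwards [hmem] with r hr
  have hrb : r < b := hr.2.trans_le (min_le_left _ _)
  have hrδ : r < s + δ := hr.2.trans_le (min_le_right _ _)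
  -- The limit in `n` is taken at fixed `r`, before `r` tends to `s`; no convergence of derivatives
  -- is needed.
  have hlim' : Tendsto (fun n => (r - s)⁻¹ • (y n r - y n s)) l (𝓝 (slope y₀ s r)) :=
    ((hlim r ⟨hr.1.le, hrb.le⟩).sub (hlim s ⟨le_rfl, hsb.le⟩)).const_smul _
  refine Metric.isClosed_cthickening.mem_of_tendsto hlim' ?_
  filter_upwards [hev] with n hn
  refine ((hy n).mono ?_).slope_mem_of_ae_hasDerivAt hr.1 (hC.cthickening ε)
    Metric.isClosed_cthickening ?_
  · rw [uIcc_of_le hsb.le, uIcc_of_le hr.1.le]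
    exact Icc_subset_Icc_right hrb.le
  · filter_upwards [ae_restrict_of_ae_restrict_of_subset (Ioo_subset_Ioo_right hrb.le) hn,
      ae_restrict_mem measurableSet_Ioo] with τ hτ hτ'
    exact hτ (hτ'.2.trans hrδ)

end AbsolutelyContinuous

/-! ### Measurable selection on compact spaces. -/

section MeasurableSelection

open Filter Topology

variable {Ω X : Type*} [MeasurableSpace Ω]

/-- By compactness a zero exists exactly when the infimum is zero, and by continuity the infimum can
be tested on a countable dense subset. -/
theorem measurableSet_exists_mem_eq_zero [PseudoMetricSpace X] {H : Ω → X → ℝ}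
    (h0 : ∀ ω u, 0 ≤ H ω u)
    (hm : ∀ u, Measurable fun ω => H ω u) (hc : ∀ ω, Continuous (H ω)) {C : Set X}
    (hC : IsCompact C) : MeasurableSet {ω | ∃ u ∈ C, H ω u = 0} := by
  obtain ⟨D, hDC, hD, hCD⟩ := hC.isSeparable.exists_countable_dense_subset
  have : {ω | ∃ u ∈ C, H ω u = 0} = ⋂ n : ℕ, ⋃ u ∈ D, {ω | H ω u < 1 / ((n : ℝ) + 1)} := by
    ext ω
    simp only [mem_ofPred_eq, mem_iInter, mem_iUnion, exists_prop]
    constructor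
    · rintro ⟨u, hu, hu0⟩ n
      have hpos : H ω u < 1 / ((n : ℝ) + 1) := by rw [hu0]; positivity
      obtain ⟨w, hw, hwD⟩ := mem_closure_iff.1 (hCD hu) _
        (isOpen_lt (hc ω) continuous_const) hpos
      exact ⟨w, hwD, hw⟩
    · intro h
      obtain ⟨w, hw, -⟩ := h 0
      obtain ⟨u, hu, hmin⟩ := hC.exists_isMinOn ⟨w, hDC hw⟩ (hc ω).continuousOn
      refine ⟨u, hu, le_antisymm (le_of_forall_pos_lt_add fun ε hε => ?_) (h0 ω u)⟩
      obtain ⟨n, hn⟩ := exists_nat_one_div_lt hε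
      obtain ⟨w', hw', hlt⟩ := h n
      rw [zero_add]
      exact (hmin (hDC hw')).trans_lt (hlt.trans hn)
  rw [this]
  exact MeasurableSet.iInter fun n => MeasurableSet.biUnion hD fun u _ =>
    measurableSet_lt (hm u) measurable_const

/-- Measurable selection of zeros of a nonnegative Carathéodory function on a compact space. -/
theorem exists_measurable_eq_zero [MetricSpace X] [CompactSpace X] [Nonempty X]
    [MeasurableSpace X] [BorelSpace X] {H : Ω → X → ℝ} (h0 : ∀ ω u, 0 ≤ H ω u)
    (hm : ∀ u, Measurable fun ω => H ω u) (hc : ∀ ω, Continuous (H ω)) :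
    ∃ σ : Ω → X, Measurable σ ∧ ∀ ω, (∃ u, H ω u = 0) → H ω (σ ω) = 0 := by
  classical
  -- Lifting to the Cantor set provides a linear order, in which the least zero is a canonical
  -- choice.
  obtain ⟨q', hq', hq's⟩ := exists_nat_bool_continuous_surjective_of_compact X
  let q : cantorSet → X := q' ∘ cantorSetHomeomorphNatToBool
  have hq : Continuous q := hq'.comp (Homeomorph.continuous _)
  have hqs : Function.Surjective q := hq's.comp (Homeomorph.surjective _)
  have : CompactSpace cantorSet := isCompact_iff_compactSpace.1 isCompact_cantorSet
  let K : Ω → cantorSet → ℝ := fun ω k => H ω (q k)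
  have hKc : ∀ ω, Continuous (K ω) := fun ω => (hc ω).comp hq
  have hmeas : ∀ C : Set cantorSet, IsCompact C → MeasurableSet {ω | ∃ k ∈ C, K ω k = 0} :=
    fun C hC => measurableSet_exists_mem_eq_zero (H := K) (fun ω k => h0 ω _) (fun k => hm _) hKc hC
  have hleast : ∀ ω, ∃ k, (∃ k', K ω k' = 0) → IsLeast {k' | K ω k' = 0} k := by
    intro ω
    by_cases h : ∃ k', K ω k' = 0
    · obtain ⟨k, hk⟩ := (isClosed_eq (hKc ω) continuous_const).isCompact.exists_isLeast h
      exact ⟨k, fun _ => hk⟩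
    · exact ⟨⟨0, zero_mem_cantorSet⟩, fun h' => absurd h' h⟩
  choose κ hκ using hleast
  let A : Set Ω := {ω | ∃ k, K ω k = 0}
  have hA : MeasurableSet A := by
    convert hmeas univ isCompact_univ using 3
    simp
  let κ₀ : cantorSet := ⟨0, zero_mem_cantorSet⟩
  let ρ : Ω → cantorSet := fun ω => if ω ∈ A then κ ω else κ₀
  have hρ : Measurable ρ := by
    -- The least zero is at most `a` exactly when some zero lies in the compact initial segment up
    -- to `a`.
    refine Measurable.subtype_mk (f := fun ω => (ρ ω : ℝ)) (measurable_of_Iic fun a => ?_)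
    have : (fun ω => (ρ ω : ℝ)) ⁻¹' Iic a =
        {ω | ∃ k ∈ {k : cantorSet | (k : ℝ) ≤ a}, K ω k = 0} ∪ (Aᶜ ∩ {_ω | (κ₀ : ℝ) ≤ a}) := by
      ext ω
      by_cases hω : ω ∈ A
      · have hl := hκ ω hω
        simp only [mem_preimage, mem_Iic, ρ, if_true, mem_union, mem_ofPred_eq, mem_inter_iff,
          mem_compl_iff, hω, not_true_eq_false, false_and, or_false]
        exact ⟨fun h => ⟨κ ω, h, hl.1⟩, fun ⟨k, hk, hk0⟩ => (Subtype.coe_le_coe.2 (hl.2 hk0)).trans hk⟩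
      · simp only [mem_preimage, mem_Iic, ρ, if_false, mem_union, mem_ofPred_eq, mem_inter_iff,
          mem_compl_iff, hω, not_false_eq_true, true_and]
        exact ⟨Or.inr, fun h => h.elim (fun ⟨k, _, hk⟩ => absurd ⟨k, hk⟩ hω) id⟩
    rw [this]
    exact (hmeas _ (isClosed_le continuous_subtype_val continuous_const).isCompact).union
      (hA.compl.inter (MeasurableSet.const _))
  refine ⟨q ∘ ρ, hq.measurable.comp hρ, fun ω ⟨u, hu⟩ => ?_⟩
  obtain ⟨k, rfl⟩ := hqs u
  have hω : ω ∈ A := ⟨k, hu⟩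
  have := (hκ ω hω).1
  simpa [ρ, hω] using this

end MeasurableSelection

/-! ### Compactness tools: uniform continuity and limits of curves. -/

section UniformContinuity

open Filter Topology

theorem ContinuousOn.exists_forall_dist_le_of_isCompact {E F Z : Type*} [PseudoMetricSpace E]
    [ProperSpace E] [PseudoMetricSpace F] [PseudoMetricSpace Z] {φ : ℝ × E × F → Z} {a b : ℝ}
    {U : Set F} (hU : IsCompact U) (hφ : ContinuousOn φ (Icc a b ×ˢ univ ×ˢ U)) {s : ℝ}
    (hs : s ∈ Icc a b) (x : E) {ε : ℝ} (hε : 0 < ε) :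
    ∃ δ > 0, ∀ τ ∈ Icc a b, dist τ s < δ → ∀ y, dist y x < δ → ∀ u ∈ U,
      dist (φ (τ, y, u)) (φ (s, x, u)) ≤ ε := by
  have hK : IsCompact (Icc a b ×ˢ Metric.closedBall x 1 ×ˢ U) :=
    isCompact_Icc.prod ((isCompact_closedBall x 1).prod hU)
  have huc := hK.uniformContinuousOn_of_continuous
    (hφ.mono (prod_mono_right (prod_mono_left (subset_univ _))))
  obtain ⟨δ, hδ, h⟩ := Metric.uniformContinuousOn_iff.1 huc ε hε
  refine ⟨min δ 1, by positivity, fun τ hτ hτs y hy u hu => (h _ ⟨hτ, ?_, hu⟩ _ ⟨hs, ?_, hu⟩ ?_).le⟩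
  · exact (hy.trans_le (min_le_right _ _)).le
  · exact Metric.mem_closedBall_self zero_le_one
  · simp only [Prod.dist_eq, dist_self, max_lt_iff]
    exact ⟨hτs.trans_le (min_le_left _ _), hy.trans_le (min_le_left _ _), hδ⟩

/-- Equi-Lipschitz curves with a common starting point converge pointwise along an ultrafilter. -/
theorem exists_lipschitzOnWith_tendsto_ultrafilter {ι A E : Type*} [PseudoMetricSpace A]
    [MetricSpace E] [ProperSpace E] (l : Ultrafilter ι) {y : ι → A → E} {K : NNReal} {S : Set A}
    {a : A} (ha : a ∈ S) {e : E} (hya : ∀ n, y n a = e) (hy : ∀ n, LipschitzOnWith K (y n) S) :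
    ∃ y₀ : A → E, LipschitzOnWith K y₀ S ∧ ∀ s ∈ S, Tendsto (fun n => y n s) l (𝓝 (y₀ s)) := by
  have hex : ∀ s, ∃ p, s ∈ S → Tendsto (fun n => y n s) l (𝓝 p) := by
    intro s
    by_cases hs : s ∈ S
    · have hmem : ∀ n, y n s ∈ Metric.closedBall e (K * dist s a) := fun n => by
        rw [Metric.mem_closedBall, ← hya n]
        exact (hy n).dist_le_mul s hs a ha
      obtain ⟨p, -, hp⟩ := (isCompact_closedBall e (K * dist s a)).ultrafilter_le_nhds
        (l.map fun n => y n s) (by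
          rw [le_principal_iff]
          exact Filter.mem_map.2 (Filter.univ_mem' hmem))
      exact ⟨p, fun _ => hp⟩
    · exact ⟨e, fun h => absurd h hs⟩
  choose y₀ hy₀ using hex
  refine ⟨y₀, LipschitzOnWith.of_dist_le_mul fun s hs r hr => ?_, hy₀⟩
  exact le_of_tendsto ((hy₀ s hs).dist (hy₀ r hr))
    (Eventually.of_forall fun n => (hy n).dist_le_mul s hs r hr)

end UniformContinuity

/-! ### Admissible velocities, a priori bounds and integrability of the cost. -/

namespace BolzaData

open Filter Topology

variable {d r mg mf : ℕ} {P : BolzaData d r mg mf}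

/-- The augmented velocities whose convexity is required by (H4). -/
def augVelocities (P : BolzaData d r mg mf) (cl s : ℝ) (x : EuclideanSpace ℝ (Fin d)) :
    Set (EuclideanSpace ℝ (Fin d) × ℝ) :=
  {p | ∃ u ∈ P.U, ∃ η : ℝ,
      -cl * (1 + ‖x‖) + P.l s x u ≤ η ∧ η ≤ 0 ∧ p = (P.f s x u, -P.l s x u + η)}

theorem continuousOn_section {Z : Type*} [TopologicalSpace Z]
    {φ : ℝ → EuclideanSpace ℝ (Fin d) → EuclideanSpace ℝ (Fin r) → Z} {a b : ℝ}
    {U : Set (EuclideanSpace ℝ (Fin r))}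
    (hφ : ContinuousOn (fun q : ℝ × EuclideanSpace ℝ (Fin d) × EuclideanSpace ℝ (Fin r) =>
      φ q.1 q.2.1 q.2.2) (Icc a b ×ˢ univ ×ˢ U)) {s : ℝ} (hs : s ∈ Icc a b)
    (x : EuclideanSpace ℝ (Fin d)) : ContinuousOn (φ s x) U :=
  hφ.comp (f := fun u => (s, x, u)) (by fun_prop) fun _ hu => ⟨hs, mem_univ _, hu⟩

theorem isClosed_augVelocities {cl : ℝ} (h0 : P.H0) (h1a : P.H1a) (h1b : P.H1b cl) {s : ℝ}
    (hs : s ∈ Icc 0 P.T) (x : EuclideanSpace ℝ (Fin d)) : IsClosed (P.augVelocities cl s x) := by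
  have hf := continuousOn_section h1a.1 hs x
  have hl := continuousOn_section h1b.1 hs x
  set c := cl * (1 + ‖x‖)
  -- Since `ℓ ≥ -c`, the lower bound `-c + ℓ ≤ η` forces `η ≥ -2c`, so the parameters `(u, η)` lie
  -- in a compact box.
  have hcomp : IsCompact (P.U ×ˢ Icc (-(2 * c)) 0) := h0.prod isCompact_Icc
  have hl' : ContinuousOn (fun q : EuclideanSpace ℝ (Fin r) × ℝ => P.l s x q.1)
      (P.U ×ˢ Icc (-(2 * c)) 0) := hl.comp continuousOn_fst fun q hq => hq.1
  have hf' : ContinuousOn (fun q : EuclideanSpace ℝ (Fin r) × ℝ => P.f s x q.1)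
      (P.U ×ˢ Icc (-(2 * c)) 0) := hf.comp continuousOn_fst fun q hq => hq.1
  have hS : IsCompact ((P.U ×ˢ Icc (-(2 * c)) 0) ∩
      (fun q => q.2 - P.l s x q.1 + c) ⁻¹' Ici 0) :=
    hcomp.of_isClosed_subset
      (((continuousOn_snd.sub hl').add continuousOn_const).preimage_isClosed_of_isClosed
        hcomp.isClosed isClosed_Ici) inter_subset_left
  convert (hS.image_of_continuousOn ((hf'.prodMk (hl'.neg.add continuousOn_snd)).mono
    inter_subset_left)).isClosed
  ext p
  simp only [augVelocities, mem_ofPred_eq, mem_image, mem_inter_iff, mem_prod, mem_Icc,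
    mem_preimage, mem_Ici, Prod.exists]
  constructor
  · rintro ⟨u, hu, η, h1, h2, rfl⟩
    have := abs_le.1 (h1b.2.2.2 s hs x u hu)
    exact ⟨u, η, ⟨⟨hu, by linarith, h2⟩, by linarith⟩, rfl⟩
  · rintro ⟨u, η, ⟨⟨hu, -, h2⟩, h3⟩, rfl⟩
    exact ⟨u, hu, η, by linarith, h2, rfl⟩

theorem mem_augVelocities {cl : ℝ} (h1b : P.H1b cl) {s : ℝ} (hs : s ∈ Icc 0 P.T)
    (x : EuclideanSpace ℝ (Fin d)) {u : EuclideanSpace ℝ (Fin r)} (hu : u ∈ P.U) :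
    (P.f s x u, -P.l s x u) ∈ P.augVelocities cl s x :=
  ⟨u, hu, 0, by have := abs_le.1 (h1b.2.2.2 s hs x u hu); linarith, le_rfl, by simp⟩

theorem exists_forall_mem_cthickening_augVelocities {cl : ℝ} (h0 : P.H0) (h1a : P.H1a)
    (h1b : P.H1b cl) {s : ℝ} (hs : s ∈ Icc 0 P.T) (x : EuclideanSpace ℝ (Fin d)) {ε : ℝ}
    (hε : 0 < ε) : ∃ δ > 0, ∀ τ ∈ Icc 0 P.T, dist τ s < δ → ∀ y, dist y x < δ → ∀ u ∈ P.U,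
      (P.f τ y u, -P.l τ y u) ∈ Metric.cthickening ε (P.augVelocities cl s x) := by
  obtain ⟨δ₁, hδ₁, h₁⟩ := h1a.1.exists_forall_dist_le_of_isCompact h0 hs x hε
  obtain ⟨δ₂, hδ₂, h₂⟩ := h1b.1.exists_forall_dist_le_of_isCompact h0 hs x hε
  refine ⟨min δ₁ δ₂, lt_min hδ₁ hδ₂, fun τ hτ hτs y hy u hu => ?_⟩
  refine Metric.mem_cthickening_of_dist_le _ _ _ _ (mem_augVelocities h1b hs x hu) ?_
  rw [Prod.dist_eq, dist_neg_neg]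
  exact max_le (h₁ τ hτ (hτs.trans_le (min_le_left _ _)) y (hy.trans_le (min_le_left _ _)) u hu)
    (h₂ τ hτ (hτs.trans_le (min_le_right _ _)) y (hy.trans_le (min_le_right _ _)) u hu)

theorem Controls.ae_mem_Ioo {u : ℝ → EuclideanSpace ℝ (Fin r)} (hu : u ∈ P.Controls) {t : ℝ}
    (ht : t ∈ Icc 0 P.T) : ∀ᵐ s ∂volume.restrict (Ioo t P.T), s ∈ Icc 0 P.T ∧ u s ∈ P.U := by
  filter_upwards [ae_restrict_of_ae_restrict_of_subset
    (Ioo_subset_Icc_self.trans (Icc_subset_Icc_left ht.1)) hu.2,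
    ae_restrict_mem measurableSet_Ioo] with s hs hs'
  exact ⟨⟨ht.1.trans hs'.1.le, hs'.2.le⟩, hs⟩

/-- As `T > 0`, the interval `[0, T]` has positive measure. Working there rather than on `[t, T]`
also covers `t = T`. -/
theorem Controls.nonempty (hT : 0 < P.T) {u : ℝ → EuclideanSpace ℝ (Fin r)}
    (hu : u ∈ P.Controls) : P.U.Nonempty := by
  have : NeBot (ae (volume.restrict (Icc 0 P.T))) := by
    rw [ae_neBot, Ne, Measure.restrict_eq_zero]
    simp [hT]
  obtain ⟨s, hs⟩ := hu.2.exists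
  exact ⟨u s, hs⟩

theorem exists_trajectory_bound (h1a : P.H1a) {t : ℝ} (ht : t ∈ Icc 0 P.T)
    (x : EuclideanSpace ℝ (Fin d)) : ∃ R : ℝ, 0 ≤ R ∧ ∀ p ∈ P.Pairs t x, ∀ s ∈ Icc t P.T,
      ‖p.1 s‖ ≤ R := by
  obtain ⟨-, -, c, hc, hf⟩ := h1a
  refine ⟨Real.exp (c * (P.T - t)) * (1 + ‖x‖), by positivity, ?_⟩
  rintro ⟨y, u⟩ ⟨hu, hy, rfl, hd⟩ s hs
  have h := hy.one_add_norm_le_of_linear_growth (c := c) (by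
    filter_upwards [hd, Controls.ae_mem_Ioo hu ht] with τ hτ hτ'
    exact ⟨_, hτ, hf τ hτ'.1 _ _ hτ'.2⟩) hs
  have : Real.exp (c * (s - t)) ≤ Real.exp (c * (P.T - t)) := by
    gcongr
    exact hs.2
  calc ‖y s‖ ≤ 1 + ‖y s‖ := by linarith
    _ ≤ _ := h
    _ ≤ _ := by gcongr

theorem intervalIntegrable_runningCost {cl : ℝ} (h0 : P.H0) (h1b : P.H1b cl) {t : ℝ}
    (ht : t ∈ Icc 0 P.T) {y : ℝ → EuclideanSpace ℝ (Fin d)} (hy : ContinuousOn y (Icc t P.T))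
    {u : ℝ → EuclideanSpace ℝ (Fin r)} (hu : u ∈ P.Controls) :
    IntervalIntegrable (fun s => P.l s (y s) (u s)) volume t P.T := by
  rw [intervalIntegrable_iff_integrableOn_Ioo_of_le ht.2]
  have hmem := Controls.ae_mem_Ioo hu ht
  have hmeas : AEMeasurable (fun s => (s, y s, u s)) (volume.restrict (Ioo t P.T)) :=
    aemeasurable_id.prodMk (((hy.mono Ioo_subset_Icc_self).aemeasurable measurableSet_Ioo).prodMk
      (hu.1.mono_measure (Measure.restrict_mono
        (Ioo_subset_Icc_self.trans (Icc_subset_Icc_left ht.1)) le_rfl)))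
  have hS : MeasurableSet (Icc 0 P.T ×ˢ (univ : Set (EuclideanSpace ℝ (Fin d))) ×ˢ P.U) :=
    measurableSet_Icc.prod (MeasurableSet.univ.prod h0.measurableSet)
  have hcomp : AEMeasurable (fun s => P.l s (y s) (u s)) (volume.restrict (Ioo t P.T)) := by
    -- The cost is continuous only on `[0,T] × ℝ^d × U`, so measurability is proved for the
    -- push-forward measure, which is concentrated there.
    have h1 := h1b.1.aemeasurable (μ := (volume.restrict (Ioo t P.T)).map
      fun s => (s, y s, u s)) hS
    rw [Measure.restrict_eq_self_of_ae_mem] at h1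
    · exact h1.comp_aemeasurable hmeas
    · refine (ae_map_iff hmeas hS).2 ?_
      filter_upwards [hmem] with s hs
      exact ⟨hs.1, mem_univ _, hs.2⟩
  obtain ⟨M, hM⟩ := isCompact_Icc.exists_bound_of_continuousOn hy
  refine Integrable.of_bound hcomp.aestronglyMeasurable (cl * (1 + M)) ?_
  filter_upwards [hmem, ae_restrict_mem measurableSet_Ioo] with s hs hs'
  have := h1b.2.2.1
  refine (h1b.2.2.2 s hs.1 _ _ hs.2).trans ?_
  gcongr
  exact hM s (Ioo_subset_Icc_self hs')

end BolzaData

/-! ### Filippov selection, passage to the limit and comparison of values. -/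

namespace BolzaData

open Filter Topology

variable {d r mg mf : ℕ} {P : BolzaData d r mg mf}

/-- Filippov's selection: a curve whose augmented velocity is almost everywhere admissible is
generated by a measurable control, at a running cost that does not exceed `-ζ'`. -/
theorem exists_control_of_ae_mem_augVelocities {cl : ℝ} (h0 : P.H0) (h1a : P.H1a)
    (h1b : P.H1b cl) (hU : P.U.Nonempty) {t : ℝ} (ht : t ∈ Icc 0 P.T)
    {ξ : ℝ → EuclideanSpace ℝ (Fin d)} {ζ : ℝ → ℝ} (hξ : ContinuousOn ξ (Icc t P.T))
    (h : ∀ᵐ s ∂volume.restrict (Ioo t P.T), (deriv ξ s, deriv ζ s) ∈ P.augVelocities cl s (ξ s)) :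
    ∃ u ∈ P.Controls, ∀ᵐ s ∂volume.restrict (Ioo t P.T),
      deriv ξ s = P.f s (ξ s) (u s) ∧ deriv ζ s ≤ -P.l s (ξ s) (u s) := by
  have : Nonempty P.U := hU.to_subtype
  have : CompactSpace P.U := isCompact_iff_compactSpace.1 h0
  -- A zero of `H` is precisely a control realizing `ξ'` at a running cost of at most `-ζ'`.
  let H : Icc t P.T → P.U → ℝ := fun s u =>
    ‖P.f s (ξ s) u - deriv ξ s‖ + max 0 (deriv ζ s + P.l s (ξ s) u)
  have hmem : ∀ s : Icc t P.T, (s : ℝ) ∈ Icc 0 P.T := fun s => ⟨ht.1.trans s.2.1, s.2.2⟩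
  have hξ' : Continuous fun s : Icc t P.T => ξ s := continuousOn_iff_continuous_domRestrict.1 hξ
  have hm : ∀ u, Measurable fun s => H s u := by
    intro u
    have hq : Continuous fun s : Icc t P.T => ((s : ℝ), ξ s, (u : EuclideanSpace ℝ (Fin r))) :=
      continuous_subtype_val.prodMk (hξ'.prodMk continuous_const)
    have hfm : Continuous fun s : Icc t P.T => P.f s (ξ s) u :=
      h1a.1.comp_continuous hq fun s => ⟨hmem s, mem_univ _, u.2⟩
    have hlm : Continuous fun s : Icc t P.T => P.l s (ξ s) u :=
      h1b.1.comp_continuous hq fun s => ⟨hmem s, mem_univ _, u.2⟩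
    exact (hfm.measurable.sub ((measurable_deriv ξ).comp measurable_subtype_coe)).norm.add
      (measurable_const.max (((measurable_deriv ζ).comp measurable_subtype_coe).add
        hlm.measurable))
  have hc : ∀ s, Continuous (H s) := by
    intro s
    have hfc : Continuous fun u : P.U => P.f s (ξ s) u :=
      continuousOn_iff_continuous_domRestrict.1 (continuousOn_section h1a.1 (hmem s) (ξ s))
    have hlc : Continuous fun u : P.U => P.l s (ξ s) u :=
      continuousOn_iff_continuous_domRestrict.1 (continuousOn_section h1b.1 (hmem s) (ξ s))
    fun_prop
  obtain ⟨σ, hσ, hσ0⟩ := exists_measurable_eq_zero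
    (fun s u => add_nonneg (norm_nonneg _) (le_max_left _ _)) hm hc
  -- Precomposing with the projection onto `[t, T]` extends the control to all times with values in
  -- `U`.
  refine ⟨fun s => σ (projIcc t P.T ht.2 s), ⟨?_, ?_⟩, ?_⟩
  · exact (measurable_subtype_coe.comp (hσ.comp continuous_projIcc.measurable)).aemeasurable
  · exact Eventually.of_forall fun s => Subtype.coe_prop _
  · filter_upwards [h, ae_restrict_mem measurableSet_Ioo] with s hs hst
    have hst' := Ioo_subset_Icc_self hst
    rw [projIcc_of_mem ht.2 hst']
    have h1 := hσ0 ⟨s, hst'⟩ (by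
      obtain ⟨u, hu, η, -, hη, heq⟩ := hs
      rw [Prod.mk.injEq] at heq
      refine ⟨⟨u, hu⟩, ?_⟩
      have : deriv ζ s + P.l s (ξ s) u ≤ 0 := by rw [heq.2]; linarith
      simp only [heq.1, sub_self, norm_zero, zero_add]
      exact max_eq_left this)
    obtain ⟨h2, h3⟩ := (add_eq_zero_iff_of_nonneg (norm_nonneg _) (le_max_left _ _)).1 h1
    refine ⟨(sub_eq_zero.1 (norm_eq_zero.1 h2)).symm, ?_⟩
    have := max_eq_left_iff.1 h3
    linarith

theorem exists_augTrajectory_lipschitzOnWith {cl : ℝ} (h1a : P.H1a) (h1b : P.H1b cl) {t : ℝ}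
    (ht : t ∈ Icc 0 P.T) (x : EuclideanSpace ℝ (Fin d)) (z : ℝ) :
    ∃ K : NNReal, ∀ y ∈ P.AugTrajectories t x z,
      LipschitzOnWith K (fun s => (y.1 s, y.2 s)) (Icc t P.T) := by
  obtain ⟨R, hR, hbound⟩ := exists_trajectory_bound h1a ht x
  obtain ⟨-, -, c, hc, hf⟩ := h1a
  obtain ⟨-, -, hcl, hl⟩ := h1b
  refine ⟨max (c * (1 + R)).toNNReal (cl * (1 + R)).toNNReal, ?_⟩
  rintro ⟨ξ, ζ⟩ ⟨hξ, hζ, hx, hz, u, hu, hd⟩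
  have hR' := hbound (ξ, u) ⟨hu, hξ, hx, hd.mono fun s hs => hs.1⟩
  have hall : ∀ᵐ s ∂volume.restrict (Ioo t P.T), ‖P.f s (ξ s) (u s)‖ ≤ c * (1 + R) ∧
      ‖-P.l s (ξ s) (u s)‖ ≤ cl * (1 + R) := by
    filter_upwards [Controls.ae_mem_Ioo hu ht, ae_restrict_mem measurableSet_Ioo] with s hs hst
    have := hR' s (Ioo_subset_Icc_self hst)
    rw [norm_neg]
    constructor
    · refine (hf s hs.1 _ _ hs.2).trans ?_
      gcongr
    · refine (hl s hs.1 _ _ hs.2).trans ?_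
      gcongr
  refine LipschitzOnWith.prodMk (hξ.lipschitzOnWith_of_ae_hasDerivAt ht.2 ?_)
    (hζ.lipschitzOnWith_of_ae_hasDerivAt ht.2 ?_)
  · filter_upwards [hd, hall] with s hs hs'
    exact ⟨_, hs.1, hs'.1.trans (Real.le_coe_toNNReal _)⟩
  · filter_upwards [hd, hall] with s hs hs'
    exact ⟨_, hs.2, hs'.2.trans (Real.le_coe_toNNReal _)⟩

/-- A pointwise limit of equi-Lipschitz augmented trajectories is a relaxed trajectory. -/
theorem mem_augVelocities_of_tendsto {cl : ℝ} (h0 : P.H0) (h1a : P.H1a) (h1b : P.H1b cl)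
    (h4 : P.H4 cl) {t : ℝ} (ht : t ∈ Icc 0 P.T) {x : EuclideanSpace ℝ (Fin d)} {z : ℝ}
    {ι : Type*} {l : Filter ι} [l.NeBot] {y : ι → (ℝ → EuclideanSpace ℝ (Fin d)) × (ℝ → ℝ)}
    (hy : ∀ n, y n ∈ P.AugTrajectories t x z) {K : NNReal}
    (hK : ∀ n, LipschitzOnWith K (fun s => ((y n).1 s, (y n).2 s)) (Icc t P.T))
    {y₀ : ℝ → EuclideanSpace ℝ (Fin d) × ℝ}
    (hlim : ∀ s ∈ Icc t P.T, Tendsto (fun n => ((y n).1 s, (y n).2 s)) l (𝓝 (y₀ s)))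
    {s : ℝ} (hs : s ∈ Ioo t P.T) {v : EuclideanSpace ℝ (Fin d) × ℝ} (hv : HasDerivAt y₀ v s) :
    v ∈ P.augVelocities cl s (y₀ s).1 := by
  have hsub : Icc s P.T ⊆ Icc t P.T := Icc_subset_Icc_left hs.1.le
  have hs0 : s ∈ Icc 0 P.T := ⟨ht.1.trans hs.1.le, hs.2.le⟩
  refine hv.mem_of_tendsto_of_ae_mem_cthickening (l := l) hs.2
    (y := fun n s => ((y n).1 s, (y n).2 s)) (fun n => ?_)
    (fun τ hτ => hlim τ (hsub hτ)) (h4 s hs0 _) (isClosed_augVelocities h0 h1a h1b hs0 _)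
    fun ε hε => ?_
  · refine LipschitzOnWith.absolutelyContinuousOnInterval (K := K) ((hK n).mono ?_)
    rwa [uIcc_of_le hs.2.le]
  obtain ⟨δ, hδ, h⟩ := exists_forall_mem_cthickening_augVelocities h0 h1a h1b hs0 (y₀ s).1 hε
  -- Over this length a `K`-Lipschitz curve moves by at most `δ/2`, leaving `δ/2` for the
  -- convergence at `s`; `K + 1` avoids dividing by zero.
  refine ⟨min δ (δ / (2 * (K + 1))), by positivity, ?_⟩
  have hlim1 := ((hlim s ⟨hs.1.le, hs.2.le⟩).fst_nhds).eventually
    (Metric.ball_mem_nhds _ (half_pos hδ))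
  filter_upwards [hlim1] with n hn
  obtain ⟨-, -, -, -, u, hu, hd⟩ := hy n
  filter_upwards [ae_restrict_of_ae_restrict_of_subset (Ioo_subset_Ioo_left hs.1.le) hd,
    ae_restrict_of_ae_restrict_of_subset (Ioo_subset_Ioo_left hs.1.le) (Controls.ae_mem_Ioo hu ht),
    ae_restrict_mem measurableSet_Ioo] with τ hτ hτu hτs hτδ
  have hdist : dist τ s = τ - s := by rw [Real.dist_eq, abs_of_pos (by linarith [hτs.1])]
  refine ⟨_, hτ.1.prodMk hτ.2, h τ hτu.1 ?_ _ ?_ _ hτu.2⟩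
  · rw [hdist]
    linarith [min_le_left δ (δ / (2 * (K + 1)))]
  · have h1 : dist ((y n).1 τ) ((y n).1 s) ≤ K * (τ - s) := by
      rw [← hdist]
      exact (le_max_left _ _).trans
        ((hK n).dist_le_mul τ (hsub (Ioo_subset_Icc_self hτs)) s ⟨hs.1.le, hs.2.le⟩)
    have h2 : τ - s < δ / (2 * (K + 1)) := by
      linarith [min_le_right δ (δ / (2 * (K + 1)))]
    have h3 : (K : ℝ) * (τ - s) ≤ δ / 2 := by
      rw [lt_div_iff₀ (by positivity)] at h2
      nlinarith [hτs.1]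
    calc dist ((y n).1 τ) (y₀ s).1 ≤ dist ((y n).1 τ) ((y n).1 s) + dist ((y n).1 s) (y₀ s).1 :=
          dist_triangle _ _ _
      _ < δ := by
          have : dist ((y n).1 s) (y₀ s).1 < δ / 2 := hn
          linarith

theorem exists_cost_le_of_W_le_zero [NeZero mg] [NeZero mf] (hT : 0 < P.T) {cl : ℝ} (h0 : P.H0)
    (h1a : P.H1a) (h1b : P.H1b cl) (h2 : P.H2) (h3 : P.H3) (h4 : P.H4 cl) {t : ℝ}
    (ht : t ∈ Icc 0 P.T) {x : EuclideanSpace ℝ (Fin d)} {z : ℝ} (hW : P.W t x z ≤ 0) :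
    ∃ p ∈ P.Pairs t x, ((∀ s ∈ Icc t P.T, ∀ i, P.g (p.1 s) i ≤ 0) ∧ ∀ j, P.gf (p.1 P.T) j ≤ 0) ∧
      P.phi (p.1 P.T) + ∫ s in t..P.T, P.l s (p.1 s) (p.2 s) ≤ z := by
  have hex : ∀ n : ℕ, ∃ y ∈ P.AugTrajectories t x z,
      P.phi (y.1 P.T) - y.2 P.T ≤ 1 / ((n : ℝ) + 1) ∧
      (∀ s ∈ Icc t P.T, ∀ i, P.g (y.1 s) i ≤ 1 / ((n : ℝ) + 1)) ∧
      ∀ j, P.gf (y.1 P.T) j ≤ 1 / ((n : ℝ) + 1) := by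
    intro n
    have hpos : (0 : EReal) < ((1 / ((n : ℝ) + 1) : ℝ) : EReal) := by
      exact_mod_cast Nat.one_div_pos_of_nat
    have hlt' := hW.trans_lt hpos
    simp only [W, iInf_lt_iff] at hlt'
    obtain ⟨y, hy, hlt⟩ := hlt'
    have hle := hlt.le
    rw [max_le_iff, max_le_iff, iSup₂_le_iff] at hle
    refine ⟨y, hy, EReal.coe_le_coe_iff.1 hle.1, fun s hs i => ?_, fun j => ?_⟩
    · exact (Finset.le_sup' (fun i => P.g (y.1 s) i) (Finset.mem_univ i)).trans
        (EReal.coe_le_coe_iff.1 (hle.2.1 s hs))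
    · exact (Finset.le_sup' (fun j => P.gf (y.1 P.T) j) (Finset.mem_univ j)).trans
        (EReal.coe_le_coe_iff.1 hle.2.2)
  choose y hy hphi hg hgf using hex
  obtain ⟨K, hK⟩ := exists_augTrajectory_lipschitzOnWith h1a h1b ht x z
  have htT : t ∈ Icc t P.T := ⟨le_rfl, ht.2⟩
  have hTT : P.T ∈ Icc t P.T := ⟨ht.2, le_rfl⟩
  -- Pointwise convergence along one ultrafilter replaces extraction of a subsequence.
  let l : Ultrafilter ℕ := hyperfilter ℕ
  obtain ⟨y₀, hy₀, hlim⟩ := exists_lipschitzOnWith_tendsto_ultrafilter l htT (e := (x, z))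
    (y := fun n s => ((y n).1 s, (y n).2 s))
    (fun n => Prod.ext (hy n).2.2.1 (hy n).2.2.2.1) fun n => hK _ (hy n)
  have hzero : Tendsto (fun n : ℕ => 1 / ((n : ℝ) + 1)) l (𝓝 0) :=
    tendsto_one_div_add_atTop_nhds_zero_nat.mono_left Nat.hyperfilter_le_atTop
  have hlim1 : ∀ s ∈ Icc t P.T, Tendsto (fun n => (y n).1 s) l (𝓝 (y₀ s).1) :=
    fun s hs => (hlim s hs).fst_nhds
  have hlim2 : ∀ s ∈ Icc t P.T, Tendsto (fun n => (y n).2 s) l (𝓝 (y₀ s).2) :=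
    fun s hs => (hlim s hs).snd_nhds
  let ξ : ℝ → EuclideanSpace ℝ (Fin d) := fun s => (y₀ s).1
  let ζ : ℝ → ℝ := fun s => (y₀ s).2
  have hy₀t : y₀ t = (x, z) := tendsto_nhds_unique (hlim t htT) (by
    have : (fun n => ((y n).1 t, (y n).2 t)) = fun _ => (x, z) :=
      funext fun n => Prod.ext (hy n).2.2.1 (hy n).2.2.2.1
    rw [this]
    exact tendsto_const_nhds)
  have hac : AbsolutelyContinuousOnInterval y₀ t P.T :=
    LipschitzOnWith.absolutelyContinuousOnInterval (by rwa [uIcc_of_le ht.2])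
  have hξ : AbsolutelyContinuousOnInterval ξ t P.T :=
    LipschitzWith.prod_fst.comp_absolutelyContinuousOnInterval hac
  have hζ : AbsolutelyContinuousOnInterval ζ t P.T :=
    LipschitzWith.prod_snd.comp_absolutelyContinuousOnInterval hac
  have hξc : ContinuousOn ξ (Icc t P.T) := by
    have := hξ.continuousOn
    rwa [uIcc_of_le ht.2] at this
  have hd : ∀ᵐ s ∂volume.restrict (Ioo t P.T), DifferentiableAt ℝ y₀ s := by
    rw [ae_restrict_iff' measurableSet_Ioo]
    filter_upwards [hac.boundedVariationOn.ae_differentiableAt_of_mem_uIcc] with s hs hs'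
    exact hs (by rw [uIcc_of_le ht.2]; exact Ioo_subset_Icc_self hs')
  have hvel : ∀ᵐ s ∂volume.restrict (Ioo t P.T),
      (deriv ξ s, deriv ζ s) ∈ P.augVelocities cl s (ξ s) := by
    filter_upwards [hd, ae_restrict_mem measurableSet_Ioo] with s hs hst
    have h := hs.hasDerivAt
    have h' := mem_augVelocities_of_tendsto h0 h1a h1b h4 ht hy (fun n => hK _ (hy n)) hlim hst h
    have hfst : HasDerivAt ξ (deriv y₀ s).1 s :=
      (ContinuousLinearMap.fst ℝ (EuclideanSpace ℝ (Fin d)) ℝ).hasFDerivAt.comp_hasDerivAt s h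
    have hsnd : HasDerivAt ζ (deriv y₀ s).2 s :=
      (ContinuousLinearMap.snd ℝ (EuclideanSpace ℝ (Fin d)) ℝ).hasFDerivAt.comp_hasDerivAt s h
    rwa [hfst.deriv, hsnd.deriv]
  -- This control serves only to show that `U` is nonempty.
  obtain ⟨-, -, -, -, u₀, hu₀, -⟩ := hy 0
  obtain ⟨u, hu, hsel⟩ := exists_control_of_ae_mem_augVelocities h0 h1a h1b
    (Controls.nonempty hT hu₀) ht hξc hvel
  have hint := intervalIntegrable_runningCost h0 h1b ht hξc hu
  refine ⟨(ξ, u), ⟨hu, hξ, congrArg Prod.fst hy₀t, ?_⟩, ⟨fun s hs i => ?_, fun j => ?_⟩, ?_⟩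
  · filter_upwards [hd, hsel] with s hs hs'
    rw [← hs'.1]
    exact hs.fst.hasDerivAt
  · have hcont : Continuous fun e => P.g e i := by
      have := h3.1.continuous
      fun_prop
    exact le_of_tendsto_of_tendsto ((hcont.tendsto _).comp (hlim1 s hs)) hzero
      (Eventually.of_forall fun n => hg n s hs i)
  · have hcont : Continuous fun e => P.gf e j := by
      have := h3.2.1.continuous
      fun_prop
    exact le_of_tendsto_of_tendsto ((hcont.tendsto _).comp (hlim1 _ hTT)) hzero
      (Eventually.of_forall fun n => hgf n j)
  · have hle : P.phi (ξ P.T) - ζ P.T ≤ 0 :=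
      le_of_tendsto_of_tendsto (((h2.1.continuous.tendsto _).comp (hlim1 _ hTT)).sub
        (hlim2 _ hTT)) hzero (Eventually.of_forall hphi)
    -- Here the one-sided relation `ζ' ≤ -ℓ` suffices.
    have hcost : ζ P.T - ζ t ≤ ∫ s in t..P.T, -P.l s (ξ s) (u s) := by
      rw [← hζ.integral_deriv_eq_sub]
      refine intervalIntegral.integral_mono_ae_restrict ht.2 hζ.intervalIntegrable_deriv
        hint.neg ?_
      rw [← restrict_Ioo_eq_restrict_Icc]
      filter_upwards [hsel] with s hs using hs.2
    rw [intervalIntegral.integral_neg] at hcost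
    have : ζ t = z := congrArg Prod.snd hy₀t
    change P.phi (ξ P.T) + ∫ s in t..P.T, P.l s (ξ s) (u s) ≤ z
    linarith

theorem W_le_of_V_lt [NeZero mg] [NeZero mf] {cl : ℝ} (h0 : P.H0) (h1b : P.H1b cl) {t : ℝ}
    (ht : t ∈ Icc 0 P.T) {x : EuclideanSpace ℝ (Fin d)} {z ε : ℝ} (hε : 0 ≤ ε)
    (hV : P.V t x < ((z + ε : ℝ) : EReal)) : P.W t x z ≤ (ε : EReal) := by
  simp only [V, iInf_lt_iff] at hV
  obtain ⟨⟨y, u⟩, ⟨⟨hu, hy, hyt, hd⟩, hg, hgf⟩, hlt⟩ := hV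
  rw [EReal.coe_lt_coe_iff] at hlt
  have hyc : ContinuousOn y (Icc t P.T) := by
    have := hy.continuousOn
    rwa [uIcc_of_le ht.2] at this
  have hint := (intervalIntegrable_runningCost h0 h1b ht hyc hu).neg
  have hconst : AbsolutelyContinuousOnInterval (fun _ : ℝ => z) t P.T :=
    ((LipschitzWith.const z).lipschitzOnWith (s := uIcc t P.T)).absolutelyContinuousOnInterval
  have hmem : (y, fun s => z + ∫ τ in t..s, -P.l τ (y τ) (u τ)) ∈ P.AugTrajectories t x z := by
    refine ⟨hy, hconst.fun_add
      (hint.absolutelyContinuousOnInterval_intervalIntegral (c := t) left_mem_uIcc),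
      hyt, by simp, u, hu, ?_⟩
    -- Lebesgue differentiation is needed because the control, hence the integrand, is merely
    -- measurable in time.
    have := (ae_restrict_iff' (μ := volume) (p := fun s => HasDerivAt
      (fun s => ∫ τ in t..s, -P.l τ (y τ) (u τ)) (-P.l s (y s) (u s)) s)
      (measurableSet_Ioo (a := t) (b := P.T))).2 (by
        filter_upwards [hint.ae_hasDerivAt_integral] with s hs hst
        exact hs (by rw [uIcc_of_le ht.2]; exact Ioo_subset_Icc_self hst) t left_mem_uIcc)
    filter_upwards [hd, this] with s hs hs'
    exact ⟨hs, hs'.const_add z⟩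
  refine (iInf₂_le _ hmem).trans (max_le ?_ (max_le (iSup₂_le fun s hs => ?_) ?_))
  · rw [EReal.coe_le_coe_iff]
    simp only [intervalIntegral.integral_neg]
    linarith
  · exact EReal.coe_le_coe_iff.2 (Finset.sup'_le _ _ fun i _ => (hg s hs i).trans hε)
  · exact EReal.coe_le_coe_iff.2 (Finset.sup'_le _ _ fun j _ => (hgf j).trans hε)

/-- All trajectories from `x` stay in one ball, where linear growth bounds the final and running
costs uniformly from below. -/
theorem V_ne_bot {cl : ℝ} (h1a : P.H1a) (h1b : P.H1b cl) (h2 : P.H2) {t : ℝ}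
    (ht : t ∈ Icc 0 P.T) (x : EuclideanSpace ℝ (Fin d)) : P.V t x ≠ ⊥ := by
  obtain ⟨R, hR, hbound⟩ := exists_trajectory_bound h1a ht x
  obtain ⟨-, c, hc, hphi⟩ := h2
  have hle : ((-(c * (1 + R)) - cl * (1 + R) * |P.T - t| : ℝ) : EReal) ≤ P.V t x := by
    refine le_iInf₂ fun p hp => EReal.coe_le_coe_iff.2 ?_
    have hb := hbound p hp.1
    have h1 : -(c * (1 + R)) ≤ P.phi (p.1 P.T) := by
      have h := (abs_le.1 (hphi (p.1 P.T))).1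
      have : c * (1 + ‖p.1 P.T‖) ≤ c * (1 + R) := by
        gcongr
        exact hb _ ⟨ht.2, le_rfl⟩
      linarith
    have h2 : ‖∫ s in t..P.T, P.l s (p.1 s) (p.2 s)‖ ≤ cl * (1 + R) * |P.T - t| := by
      refine intervalIntegral.norm_integral_le_of_norm_le_const_ae ?_
      rw [uIoc_of_le ht.2, ← ae_restrict_iff' measurableSet_Ioc, ← restrict_Ioo_eq_restrict_Ioc]
      filter_upwards [Controls.ae_mem_Ioo hp.1.1 ht, ae_restrict_mem measurableSet_Ioo]
        with s hs hst
      have := h1b.2.2.1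
      refine (h1b.2.2.2 s hs.1 _ _ hs.2).trans ?_
      gcongr
      exact hb s (Ioo_subset_Icc_self hst)
    have := (abs_le.1 h2).1
    linarith
  intro h
  rw [h, le_bot_iff] at hle
  exact EReal.coe_ne_bot _ hle

end BolzaData

theorem mainTheorem2 {d r mg mf : ℕ} [NeZero d] [NeZero r] [NeZero mg] [NeZero mf]
    (P : BolzaData d r mg mf) (hT : 0 < P.T) (cl : ℝ)
    (h0 : P.H0) (h1a : P.H1a) (h1b : P.H1b cl) (h2 : P.H2) (h3 : P.H3) (h4 : P.H4 cl)
    (t : ℝ) (ht : t ∈ Set.Icc 0 P.T) (x : EuclideanSpace ℝ (Fin d)) :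
    (∀ z : ℝ, P.V t x ≤ (z : EReal) ↔ P.W t x z ≤ 0) ∧
      (P.V t x = ⨅ z ∈ {z : ℝ | P.W t x z ≤ 0}, (z : EReal)) ∧
      ({z : ℝ | P.W t x z ≤ 0}.Nonempty →
        ∃ v : ℝ, P.V t x = (v : EReal) ∧ IsLeast {z : ℝ | P.W t x z ≤ 0} v) := by
  have key : ∀ z : ℝ, P.V t x ≤ (z : EReal) ↔ P.W t x z ≤ 0 := by
    refine fun z => ⟨fun hV => ?_, fun hW => ?_⟩
    · refine EReal.le_of_forall_lt_iff_le.1 fun ε hε => ?_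
      have hε' : 0 < ε := by exact_mod_cast hε
      exact BolzaData.W_le_of_V_lt h0 h1b ht hε'.le
        (hV.trans_lt (EReal.coe_lt_coe_iff.2 (lt_add_of_pos_right z hε')))
    · obtain ⟨p, hp, hc, hle⟩ :=
        BolzaData.exists_cost_le_of_W_le_zero hT h0 h1a h1b h2 h3 h4 ht hW
      exact (iInf₂_le p ⟨hp, hc⟩).trans (EReal.coe_le_coe_iff.2 hle)
  refine ⟨key, le_antisymm (le_iInf₂ fun z hz => (key z).2 hz) ?_, ?_⟩
  -- Every real above the value lies in the set; if the value is `+∞`, the condition is vacuous.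
  · exact EReal.le_of_forall_lt_iff_le.1 fun z hz => iInf₂_le z ((key z).1 hz.le)
  · rintro ⟨z, hz⟩
    have htop : P.V t x ≠ ⊤ := ne_top_of_le_ne_top (EReal.coe_ne_top z) ((key z).2 hz)
    have hv := EReal.coe_toReal htop (BolzaData.V_ne_bot h1a h1b h2 ht x)
    refine ⟨(P.V t x).toReal, hv.symm, (key _).1 hv.ge, fun w hw => ?_⟩
    rw [← EReal.coe_le_coe_iff, hv]
    exact (key w).2 hw
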